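/- Let $q\in\mathbb{C}$ with $|q|<1$, and let $\mathcal{O}_2^q$ be the universal unital $C^*$-algebra generated by two isometries $s_1,s_2$ (that is, $s_1^*s_1=s_2^*s_2=1$) satisfying $s_1^*s_2=q\,s_2s_1^*$; the norm of a $*$-polynomial in $s_1,s_2$ is the supremum of its norms under all representations of these relations on complex Hilbert spaces. A \emph{Fock representation} of $\mathcal{O}_2^q$ is an irreducible unital $*$-representation $\pi$ on a nonzero complex Hilbert space $H$ for which there is a nonzero vector $\Omega\in H$ (the vacuum) with $\pi(s_1)^*\Omega=\pi(s_2)^*\Omega=0$. Then a Fock representation of $\mathcal{O}_2^q$ exists, it is unique up to unitary equivalence, and it is faithful: its kernel in the $C^*$-algebra $\mathcal{O}_2^q$ is $\{0\}$. -/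

import Mathlib

open scoped ENNReal

universe u v w

namespace QIsom

/-- A pair of isometries `S₁, S₂` on a nonzero complex Hilbert space `H` (with `H : Type u`)
satisfying the relation `S₁* S₂ = q S₂ S₁*`. On bounded operators `star` is the Hilbert space
adjoint. -/
structure HilbertPair (q : ℂ) : Type (u + 1) where
  H : Type u
  [normed : NormedAddCommGroup H]
  [inner : InnerProductSpace ℂ H]
  [complete : CompleteSpace H]
  [nontrivial : Nontrivial H]
  S₁ : H →L[ℂ] H
  S₂ : H →L[ℂ] H
  isometry₁ : star S₁ * S₁ = 1
  isometry₂ : star S₂ * S₂ = 1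
  rel : star S₁ * S₂ = q • (S₂ * star S₁)

attribute [instance] HilbertPair.normed HilbertPair.inner HilbertPair.complete
  HilbertPair.nontrivial

/-- The C*-algebra of all uniformly bounded families of operators, one operator on the Hilbert
space of each pair of isometries satisfying the relation; operations are pointwise and the norm
is the supremum of the operator norms. -/
def Families (q : ℂ) : Type (u + 1) :=
  lp (fun P : HilbertPair.{u} q => P.H →L[ℂ] P.H) ∞

noncomputable instance (q : ℂ) : NormedRing (Families.{u} q) :=
  inferInstanceAs (NormedRing (lp (fun P : HilbertPair.{u} q => P.H →L[ℂ] P.H) ∞))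

noncomputable instance (q : ℂ) : StarRing (Families.{u} q) :=
  inferInstanceAs (StarRing (lp (fun P : HilbertPair.{u} q => P.H →L[ℂ] P.H) ∞))

noncomputable instance (q : ℂ) : NormedAlgebra ℂ (Families.{u} q) :=
  inferInstanceAs (NormedAlgebra ℂ (lp (fun P : HilbertPair.{u} q => P.H →L[ℂ] P.H) ∞))

instance (q : ℂ) : CompleteSpace (Families.{u} q) :=
  inferInstanceAs (CompleteSpace (lp (fun P : HilbertPair.{u} q => P.H →L[ℂ] P.H) ∞))

instance (q : ℂ) : CStarRing (Families.{u} q) :=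
  inferInstanceAs (CStarRing (lp (fun P : HilbertPair.{u} q => P.H →L[ℂ] P.H) ∞))

instance (q : ℂ) : StarModule ℂ (Families.{u} q) :=
  inferInstanceAs (StarModule ℂ (lp (fun P : HilbertPair.{u} q => P.H →L[ℂ] P.H) ∞))

noncomputable instance (q : ℂ) : CStarAlgebra (Families.{u} q) where

/-- The operator that a family has on the Hilbert space of the pair `P`. -/
noncomputable def Families.eval {q : ℂ} (P : HilbertPair.{u} q) :
    Families.{u} q →⋆ₐ[ℂ] (P.H →L[ℂ] P.H) where
  toFun a := a.1 P
  map_one' := rfl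
  map_mul' _ _ := rfl
  map_zero' := rfl
  map_add' _ _ := rfl
  commutes' _ := rfl
  map_star' _ := rfl

lemma Families.ext {q : ℂ} {a b : Families.{u} q} (h : ∀ P, eval P a = eval P b) : a = b :=
  lp.ext <| funext h

lemma Families.norm_eval_le {q : ℂ} (P : HilbertPair.{u} q) (a : Families.{u} q) :
    ‖eval P a‖ ≤ ‖a‖ :=
  lp.norm_apply_le_norm ENNReal.top_ne_zero
    (E := fun P : HilbertPair.{u} q => P.H →L[ℂ] P.H) a P

lemma Families.norm_le {q : ℂ} {a : Families.{u} q} {C : ℝ} (hC : 0 ≤ C)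
    (h : ∀ P, ‖eval P a‖ ≤ C) : ‖a‖ ≤ C :=
  lp.norm_le_of_forall_le (E := fun P : HilbertPair.{u} q => P.H →L[ℂ] P.H) hC h

lemma norm_le_one_of_isometry {A : Type*} [CStarAlgebra A] [Nontrivial A] {a : A}
    (h : star a * a = 1) : ‖a‖ ≤ 1 := by
  have h1 : ‖a‖ * ‖a‖ = 1 := by rw [← CStarRing.norm_star_mul_self, h, norm_one]
  nlinarith [norm_nonneg a]

/-- The family of all the first isometries. -/
noncomputable def univ₁ (q : ℂ) : Families.{u} q :=
  ⟨fun P => P.S₁, memℓp_infty ⟨1, by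
    rintro _ ⟨P, rfl⟩; exact norm_le_one_of_isometry P.isometry₁⟩⟩

/-- The family of all the second isometries. -/
noncomputable def univ₂ (q : ℂ) : Families.{u} q :=
  ⟨fun P => P.S₂, memℓp_infty ⟨1, by
    rintro _ ⟨P, rfl⟩; exact norm_le_one_of_isometry P.isometry₂⟩⟩

/-- The closed unital *-subalgebra generated by the two universal isometries. -/
noncomputable def universalSubalgebra (q : ℂ) : StarSubalgebra ℂ (Families.{u} q) :=
  (StarAlgebra.adjoin ℂ {univ₁ q, univ₂ q}).topologicalClosure

instance (q : ℂ) : IsClosed (universalSubalgebra.{u} q : Set (Families.{u} q)) :=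
  StarSubalgebra.isClosed_topologicalClosure _

/-- `O₂^q`, the universal unital C*-algebra generated by isometries `s₁, s₂` with
`s₁* s₂ = q s₂ s₁*`. The norm of a *-polynomial in `s₁, s₂` is the supremum of its norms under
all representations of the relations on Hilbert spaces. See `O₂.s₁_isometry`, `O₂.s₂_isometry`,
`O₂.s_rel`, `O₂.dense_adjoin` and `O₂.lift` for the universal property. -/
abbrev O₂ (q : ℂ) : Type (u + 1) := universalSubalgebra.{u} q

namespace O₂

/-- The first generator of `O₂^q`. -/
noncomputable def s₁ (q : ℂ) : O₂.{u} q :=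
  ⟨univ₁ q, StarSubalgebra.le_topologicalClosure _
    (StarAlgebra.subset_adjoin ℂ _ (Set.mem_insert _ _))⟩

/-- The second generator of `O₂^q`. -/
noncomputable def s₂ (q : ℂ) : O₂.{u} q :=
  ⟨univ₂ q, StarSubalgebra.le_topologicalClosure _
    (StarAlgebra.subset_adjoin ℂ _ (Set.mem_insert_of_mem _ rfl))⟩

lemma s₁_isometry (q : ℂ) : star (s₁.{u} q) * s₁ q = 1 :=
  Subtype.ext <| Families.ext fun P => P.isometry₁

lemma s₂_isometry (q : ℂ) : star (s₂.{u} q) * s₂ q = 1 :=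
  Subtype.ext <| Families.ext fun P => P.isometry₂

lemma s_rel (q : ℂ) : star (s₁.{u} q) * s₂ q = q • (s₂ q * star (s₁ q)) :=
  Subtype.ext <| Families.ext fun P => P.rel

lemma dense_adjoin (q : ℂ) :
    (StarAlgebra.adjoin ℂ {s₁.{u} q, s₂ q}).topologicalClosure = ⊤ := by
  refine top_unique fun x _ => ?_
  have key : StarSubalgebra.map (universalSubalgebra.{u} q).subtype
      (StarAlgebra.adjoin ℂ {s₁.{u} q, s₂ q}) = StarAlgebra.adjoin ℂ {univ₁ q, univ₂ q} := by
    rw [StarAlgHom.map_adjoin, Set.image_pair]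
    rfl
  change x ∈ closure (StarAlgebra.adjoin ℂ {s₁.{u} q, s₂ q} : Set (O₂.{u} q))
  rw [closure_subtype]
  have hx : (x : Families.{u} q) ∈
      closure (StarAlgebra.adjoin ℂ {univ₁ q, univ₂ q} : Set (Families.{u} q)) := x.2
  rw [← key] at hx
  exact hx

/-- Every pair of isometries satisfying the relation comes from a representation of `O₂^q`. -/
noncomputable def lift {q : ℂ} (P : HilbertPair.{u} q) : O₂.{u} q →⋆ₐ[ℂ] (P.H →L[ℂ] P.H) :=
  (Families.eval P).comp (universalSubalgebra.{u} q).subtype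

lemma lift_s₁ {q : ℂ} (P : HilbertPair.{u} q) : lift P (s₁ q) = P.S₁ := rfl

lemma lift_s₂ {q : ℂ} (P : HilbertPair.{u} q) : lift P (s₂ q) = P.S₂ := rfl

end O₂

section Representations

variable {H : Type v} [NormedAddCommGroup H] [InnerProductSpace ℂ H] [CompleteSpace H]

/-- A *-representation on a Hilbert space is irreducible if the space is nonzero and its only
closed invariant subspaces are the trivial ones. -/
def IsIrreducibleRep {A : Type w} [CStarAlgebra A] (π : A →⋆ₐ[ℂ] (H →L[ℂ] H)) : Prop :=
  Nontrivial H ∧ ∀ K : Submodule ℂ H, IsClosed (K : Set H) →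
    (∀ a : A, ∀ x ∈ K, π a x ∈ K) → K = ⊥ ∨ K = ⊤

/-- A Fock representation of `O₂^q`: an irreducible *-representation that has a vacuum vector
`Ω`, that is, a nonzero vector with `π(s₁)* Ω = 0 = π(s₂)* Ω`. -/
def IsFockRep {q : ℂ} (π : O₂.{u} q →⋆ₐ[ℂ] (H →L[ℂ] H)) : Prop :=
  IsIrreducibleRep π ∧
    ∃ Ω : H, Ω ≠ 0 ∧ star (π (O₂.s₁ q)) Ω = 0 ∧ star (π (O₂.s₂ q)) Ω = 0

end Representations

end QIsom

/-!
Three facts give the theorem: a vacuum vector determines a representation up to scale, the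
generators can be replaced by isometries with orthogonal ranges, and every pair of isometries with
orthogonal ranges is approximated by the creation operators of a Fock space.

*Vacuum vectors.* The relations allow every `*`-polynomial in `s₁, s₂` to be Wick ordered, that
is, written as a combination of products `s_a s_b*` of words (`mem_wickSpan_of_mem_adjoin`). A
vacuum `Ω` kills all of these in `⟪Ω, π(·) Ω⟫` except the empty product, so the vacuum functional
is the same for all vacua up to the factor `‖Ω‖²`, and `‖π(a) Ω‖ ‖ξ‖ = ‖σ(a) ξ‖ ‖Ω‖` for vacua `Ω`
of `π` and `ξ` of `σ` (`IsVacuum.norm_mul_norm_eq`). In an irreducible representation `Ω` is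
cyclic, which gives uniqueness (`IsFockRep.exists_unitary`).

*Orthogonal generators.* Let `p = s₁ s₁*` and `c = √(1 - |q|²)`. Then `t = (1 - p) s₂ (1 - p + c⁻¹
p)` is an isometry with `s₁* t = 0`, and `s₂` is recovered from `s₁` and `t` as the unique
solution of `x = t (1 - p + c p) + q s₁ x s₁*`, a fixed point of a contraction. Conversely,
solving this equation turns isometries `s₁, t` with orthogonal ranges into isometries `s₁, s₂`
satisfying the relation (`exists_pair_of_orthogonal`). On the full Fock space over two letters the
creation operators thus give a representation of `O₂^q`; it is irreducible because `1 - ∑ Lᵢ Lᵢ*`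
is the projection onto the vacuum (`exists_isFockRep`).

*Faithfulness.* Let `π` be a Fock representation, `π(a) = 0`, and let `τ` be any representation,
on `G`. The same construction gives a representation `σ` on `ℓ²(words; G)`, in which every vector
of `G`, placed at the empty word, is a vacuum; these vacua generate the space, so `σ(a) = 0` by
the norm identity (`IsFockRep.fockAction_eq_zero`). With `T₁, T₂` the images of `s₁, t` under `τ`
and `r < 1`, the Poisson kernel `K h = ∑ r^|w| e_w ⊗ (1 - r² ∑ Tᵢ Tᵢ*)^(1/2) T_w* h` is an
isometry from `G` to `ℓ²(words; G)` satisfying `Lᵢ* K = r K Tᵢ*` and `‖Lᵢ K - K Tᵢ‖ ≤ (1 - r) +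
√(1 - r²)` (`exists_asymptotic_intertwiner`). As `r → 1` these kernels asymptotically intertwine
`σ` and `τ` on the closed subalgebra generated by `s₁, t` and their adjoints, which is all of
`O₂^q`. Hence `‖τ(a) h‖ = ‖K τ(a) h‖` is arbitrarily close to `‖σ(a) K h‖ = 0`
(`IsFockAction.eq_zero_of_eq_zero`).
-/

namespace QIsom

open Filter Topology

/-! ### The equation `x = c + q a x b` -/

section FixedPoint

variable {A : Type*} [NormedRing A] [NormedAlgebra ℂ A]

lemma norm_conj_sub_le {a b : A} (ha : ‖a‖ ≤ 1) (hb : ‖b‖ ≤ 1) (q : ℂ) (x y : A) :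
    ‖q • (a * x * b) - q • (a * y * b)‖ ≤ ‖q‖ * ‖x - y‖ := by
  rw [← smul_sub, norm_smul, ← sub_mul, ← mul_sub]
  refine mul_le_mul_of_nonneg_left ?_ (norm_nonneg q)
  calc ‖a * (x - y) * b‖ ≤ ‖a‖ * ‖x - y‖ * ‖b‖ :=
        (norm_mul_le _ _).trans (mul_le_mul_of_nonneg_right (norm_mul_le _ _) (norm_nonneg _))
    _ ≤ 1 * ‖x - y‖ * 1 := by gcongr
    _ = ‖x - y‖ := by ring

lemma eq_of_conj_fixed {q : ℂ} (hq : ‖q‖ < 1) {a b c x y : A} (ha : ‖a‖ ≤ 1) (hb : ‖b‖ ≤ 1)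
    (hx : x = c + q • (a * x * b)) (hy : y = c + q • (a * y * b)) : x = y := by
  have h : ‖x - y‖ ≤ ‖q‖ * ‖x - y‖ := by
    have := norm_conj_sub_le ha hb q x y
    rwa [← add_sub_add_left_eq_sub _ _ c, ← hx, ← hy] at this
  have h0 : ‖x - y‖ = 0 := by nlinarith [norm_nonneg (x - y)]
  exact sub_eq_zero.1 (norm_eq_zero.1 h0)

lemma exists_conj_fixed [CompleteSpace A] {q : ℂ} (hq : ‖q‖ < 1) {a b : A} (ha : ‖a‖ ≤ 1)
    (hb : ‖b‖ ≤ 1) (c : A) : ∃ x, x = c + q • (a * x * b) := by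
  have h : ContractingWith ‖q‖₊ fun x : A => c + q • (a * x * b) := by
    refine ⟨by exact_mod_cast hq, LipschitzWith.of_dist_le_mul fun x y => ?_⟩
    rw [dist_add_left, dist_eq_norm, dist_eq_norm]
    exact norm_conj_sub_le ha hb q x y
  exact ⟨_, h.fixedPoint_isFixedPt.symm⟩

lemma mem_of_conj_fixed [CompleteSpace A] {q : ℂ} (hq : ‖q‖ < 1) {a b c x : A}
    (ha : ‖a‖ ≤ 1) (hb : ‖b‖ ≤ 1) (hx : x = c + q • (a * x * b)) {B : Subalgebra ℂ A}
    (hB : IsClosed (B : Set A)) (haB : a ∈ B) (hbB : b ∈ B) (hcB : c ∈ B) : x ∈ B := by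
  have : CompleteSpace B := hB.completeSpace_coe
  obtain ⟨y, hy⟩ := exists_conj_fixed hq (a := (⟨a, haB⟩ : B)) (b := ⟨b, hbB⟩) ha hb ⟨c, hcB⟩
  rw [eq_of_conj_fixed hq ha hb hx (congrArg Subtype.val hy)]
  exact y.2

end FixedPoint

/-! ### Isometries with the `q`-relation and isometries with orthogonal ranges -/

section Correspondence

lemma norm_le_one_of_star_mul_self {A : Type*} [CStarAlgebra A] {a : A} (h : star a * a = 1) :
    ‖a‖ ≤ 1 := by
  nontriviality A
  exact norm_le_one_of_isometry h

variable {A : Type*} [CStarAlgebra A]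

/-- For a projection `p`, the operator acting as `1` on the kernel of `p` and as `c` on its range.
Only real `c` are needed, which makes `damp c p` self-adjoint. -/
def damp (c : ℝ) (p : A) : A := 1 - p + (c : ℂ) • p

lemma damp_mul_damp (c d : ℝ) {p : A} (hp : p * p = p) :
    damp c p * damp d p = damp (c * d) p := by
  simp only [damp, add_mul, mul_add, sub_mul, mul_sub, one_mul, mul_one, smul_mul_assoc,
    mul_smul_comm, hp, Complex.ofReal_mul]
  module

lemma star_damp (c : ℝ) {p : A} (hp : star p = p) : star (damp c p) = damp c p := by
  simp [damp, hp]

lemma damp_one (p : A) : damp 1 p = 1 := by simp [damp]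

/-- The number `c = √(1 - |q|²)`, by which the part of `s₂` with range orthogonal to that of `s₁`
scales lengths on the range of `s₁`. -/
noncomputable def damping (q : ℂ) : ℝ := √(1 - ‖q‖ ^ 2)

lemma damping_pos {q : ℂ} (hq : ‖q‖ < 1) : 0 < damping q :=
  Real.sqrt_pos.2 (by nlinarith [norm_nonneg q])

lemma damping_mul_self {q : ℂ} (hq : ‖q‖ < 1) : damping q * damping q = 1 - ‖q‖ ^ 2 :=
  Real.mul_self_sqrt (by nlinarith [norm_nonneg q])

/-- The partner of `s₁` with orthogonal range extracted from `s₂`: the isometry in the polar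
decomposition of `(1 - s₁ s₁*) s₂`, whose absolute value is `damp c (s₁ s₁*)`. -/
noncomputable def orthPart (q : ℂ) (s₁ s₂ : A) : A :=
  (1 - s₁ * star s₁) * s₂ * damp (damping q)⁻¹ (s₁ * star s₁)

lemma range_proj_idem {s : A} (h : star s * s = 1) : s * star s * (s * star s) = s * star s := by
  rw [mul_assoc, ← mul_assoc (star s), h, one_mul]

lemma one_sub_range_proj_mul {s : A} (h : star s * s = 1) : (1 - s * star s) * s = 0 := by
  rw [sub_mul, one_mul, mul_assoc, h, mul_one, sub_self]

lemma star_mul_one_sub_range_proj {s : A} (h : star s * s = 1) :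
    star s * (1 - s * star s) = 0 := by
  rw [mul_sub, mul_one, ← mul_assoc, h, one_mul, sub_self]

lemma star_mul_orthPart (q : ℂ) {s₁ : A} (s₂ : A) (h₁ : star s₁ * s₁ = 1) :
    star s₁ * orthPart q s₁ s₂ = 0 := by
  rw [orthPart, ← mul_assoc, ← mul_assoc, star_mul_one_sub_range_proj h₁, zero_mul, zero_mul]

lemma star_orthPart_mul_self {q : ℂ} (hq : ‖q‖ < 1) {s₁ s₂ : A} (h₁ : star s₁ * s₁ = 1)
    (h₂ : star s₂ * s₂ = 1) (hr : star s₁ * s₂ = q • (s₂ * star s₁)) :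
    star (orthPart q s₁ s₂) * orthPart q s₁ s₂ = 1 := by
  have hp := range_proj_idem h₁
  have hps : star (s₁ * star s₁) = s₁ * star s₁ := by simp
  have hc := (damping_pos hq).ne'
  have hr' : star s₂ * s₁ = star q • (s₁ * star s₂) := by
    simpa using congrArg star hr
  have key : star s₂ * ((1 - s₁ * star s₁) * s₂) =
      damp (damping q) (s₁ * star s₁) * damp (damping q) (s₁ * star s₁) := by
    have e : star s₂ * (s₁ * star s₁ * s₂) = ((‖q‖ ^ 2 : ℝ) : ℂ) • (s₁ * star s₁) := by
      calc star s₂ * (s₁ * star s₁ * s₂) = (star s₂ * s₁) * (star s₁ * s₂) := by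
            simp only [mul_assoc]
        _ = (star q * q) • (s₁ * (star s₂ * s₂) * star s₁) := by
            rw [hr, hr']
            simp only [smul_mul_assoc, mul_smul_comm, smul_smul, mul_assoc, mul_comm q]
        _ = _ := by
            rw [h₂, mul_one]
            congr 1
            rw [Complex.star_def, Complex.conj_mul']
            push_cast; rfl
    rw [damp_mul_damp _ _ hp, damping_mul_self hq, sub_mul, one_mul, mul_sub, h₂, e, damp]
    push_cast
    module
  have e1 : star (orthPart q s₁ s₂) * orthPart q s₁ s₂ =
      damp (damping q)⁻¹ (s₁ * star s₁) * (star s₂ * ((1 - s₁ * star s₁) * s₂)) *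
        damp (damping q)⁻¹ (s₁ * star s₁) := by
    have hE : (1 - s₁ * star s₁) * (1 - s₁ * star s₁) = 1 - s₁ * star s₁ := by
      rw [mul_sub, mul_one, ← mul_assoc, one_sub_range_proj_mul h₁, zero_mul, sub_zero]
    simp only [orthPart, star_mul, star_damp _ hps, star_sub, star_one, star_star]
    conv_rhs => rw [← hE]
    simp only [mul_assoc]
  rw [e1, key, ← mul_assoc, damp_mul_damp _ _ hp, mul_assoc, damp_mul_damp _ _ hp,
    inv_mul_cancel₀ hc, mul_inv_cancel₀ hc, damp_one, mul_one]

/-- The equation that recovers `s₂` from `s₁` and `orthPart q s₁ s₂`: the two summands are the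
components of `s₂` with range orthogonal to, and contained in, that of `s₁`. -/
lemma eq_orthPart_add {q : ℂ} (hq : ‖q‖ < 1) {s₁ s₂ : A} (h₁ : star s₁ * s₁ = 1)
    (hr : star s₁ * s₂ = q • (s₂ * star s₁)) :
    s₂ = orthPart q s₁ s₂ * damp (damping q) (s₁ * star s₁) + q • (s₁ * s₂ * star s₁) := by
  rw [orthPart, mul_assoc, damp_mul_damp _ _ (range_proj_idem h₁),
    inv_mul_cancel₀ (damping_pos hq).ne', damp_one, mul_one, sub_mul, one_mul, mul_assoc, hr,
    mul_smul_comm, mul_assoc, sub_add_cancel]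

/-- The converse of the passage from `s₂` to `orthPart q s₁ s₂`: isometries with orthogonal ranges
come from a pair that satisfies the `q`-relation. -/
lemma exists_pair_of_orthogonal {q : ℂ} (hq : ‖q‖ < 1) {s t : A} (hs : star s * s = 1)
    (ht : star t * t = 1) (hst : star s * t = 0) :
    ∃ s₂ : A, star s₂ * s₂ = 1 ∧ star s * s₂ = q • (s₂ * star s) ∧ orthPart q s s₂ = t := by
  have hn := norm_le_one_of_star_mul_self hs
  have hn' : ‖star s‖ ≤ 1 := by rwa [norm_star]
  have hp := range_proj_idem hs
  have hps : star (s * star s) = s * star s := by simp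
  have hts : star t * s = 0 := by simpa using congrArg star hst
  obtain ⟨x, hx⟩ := exists_conj_fixed hq hn hn' (t * damp (damping q) (s * star s))
  set D := damp (damping q) (s * star s) with hD
  refine ⟨x, ?_, ?_, ?_⟩
  · have hq2 : ‖((‖q‖ ^ 2 : ℝ) : ℂ)‖ < 1 := by
      rw [Complex.norm_real, norm_pow, norm_norm]
      nlinarith [norm_nonneg q]
    have hDD : D * D = 1 - ((‖q‖ ^ 2 : ℝ) : ℂ) • (s * star s) := by
      rw [hD, damp_mul_damp _ _ hp, damping_mul_self hq, damp]
      push_cast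
      module
    -- both `x* x` and `1` solve `y = D² + |q|² s y s*`
    refine eq_of_conj_fixed hq2 (c := D * D) hn hn' ?_ ?_
    · have hxs : star x = D * star t + star q • (s * star x * star s) := by
        conv_lhs => rw [hx]
        simp [hD, star_damp _ hps, mul_assoc]
      have e1 : D * star t * (t * D) = D * D := by
        rw [mul_assoc, ← mul_assoc (star t), ht, one_mul]
      have e2 : D * star t * (s * x * star s) = 0 := by
        simp only [mul_assoc]
        rw [← mul_assoc (star t), hts, zero_mul, mul_zero]
      have e3 : s * star x * star s * (t * D) = 0 := by
        simp only [mul_assoc]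
        rw [← mul_assoc (star s), hst, zero_mul, mul_zero, mul_zero]
      have e4 : s * star x * star s * (s * x * star s) = s * (star x * x) * star s := by
        simp only [mul_assoc]
        rw [← mul_assoc (star s) s, hs, one_mul]
      calc star x * x = (D * star t + star q • (s * star x * star s)) *
            (t * D + q • (s * x * star s)) := by rw [← hxs, ← hx]
        _ = D * D + (star q * q) • (s * (star x * x) * star s) := by
          simp only [add_mul, mul_add, smul_mul_assoc, mul_smul_comm, e1, e2, e3, e4, smul_zero,
            add_zero, zero_add, smul_smul, mul_comm q]
        _ = _ := ?_
      rw [Complex.star_def, Complex.conj_mul']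
      push_cast; rfl
    · rw [hDD, mul_one, sub_add_cancel]
  · conv_lhs => rw [hx]
    rw [mul_add, ← mul_assoc, hst, zero_mul, zero_add, mul_smul_comm, ← mul_assoc, ← mul_assoc, hs,
      one_mul]
  · have e : (1 - s * star s) * x = t * D := by
      conv_lhs => rw [hx]
      rw [mul_add, mul_smul_comm, ← mul_assoc _ (s * x), ← mul_assoc _ s,
        one_sub_range_proj_mul hs, zero_mul, zero_mul, smul_zero, add_zero, sub_mul, one_mul,
        mul_assoc s, ← mul_assoc (star s), hst, zero_mul, mul_zero, sub_zero]
    rw [orthPart, e, mul_assoc, damp_mul_damp _ _ hp, mul_inv_cancel₀ (damping_pos hq).ne',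
      damp_one, mul_one]

lemma map_orthPart {B : Type*} [CStarAlgebra B] (f : A →⋆ₐ[ℂ] B) (q : ℂ) (s₁ s₂ : A) :
    f (orthPart q s₁ s₂) = orthPart q (f s₁) (f s₂) := by
  simp [orthPart, damp, map_star f]

end Correspondence

/-! ### Wick ordering -/

section Wick

variable {A : Type*} [CStarAlgebra A] {ι : Type*}

/-- The span of the Wick ordered monomials `s_a s_b*`, where `a` and `b` are words in the letters
`ι` and `s_a` is the product of the `s i` along `a`. -/
noncomputable def wickSpan (s : ι → A) : Submodule ℂ A :=
  Submodule.span ℂ {x | ∃ a b : List ι, x = (a.map s).prod * star (b.map s).prod}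

variable {s : ι → A}

lemma word_mul_star_word_mem_wickSpan (s : ι → A) (a b : List ι) :
    (a.map s).prod * star (b.map s).prod ∈ wickSpan s :=
  Submodule.subset_span ⟨a, b, rfl⟩

lemma mul_mem_wickSpan (i : ι) {x : A} (hx : x ∈ wickSpan s) : s i * x ∈ wickSpan s := by
  have : wickSpan s ≤ (wickSpan s).comap (LinearMap.mulLeft ℂ (s i)) := by
    refine Submodule.span_le.2 ?_
    rintro _ ⟨a, b, rfl⟩
    simpa [mul_assoc] using word_mul_star_word_mem_wickSpan s (i :: a) b
  exact this hx

lemma mul_star_word_mem_wickSpan (b : List ι) {x : A} (hx : x ∈ wickSpan s) :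
    x * star (b.map s).prod ∈ wickSpan s := by
  have : wickSpan s ≤ (wickSpan s).comap (LinearMap.mulRight ℂ (star (b.map s).prod)) := by
    refine Submodule.span_le.2 ?_
    rintro _ ⟨a, c, rfl⟩
    simpa [mul_assoc] using word_mul_star_word_mem_wickSpan s a (b ++ c)
  exact this hx

/-- Wick ordering: an annihilator is moved to the right through a word of creators, one letter at a
time. -/
lemma star_mul_mem_wickSpan {c Q : ι → ι → ℂ}
    (h : ∀ i j, star (s i) * s j = c i j • 1 + Q i j • (s j * star (s i)))
    (i : ι) {x : A} (hx : x ∈ wickSpan s) : star (s i) * x ∈ wickSpan s := by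
  have key : ∀ a : List ι, star (s i) * (a.map s).prod ∈ wickSpan s := by
    intro a
    induction a with
    | nil => simpa using word_mul_star_word_mem_wickSpan s [] [i]
    | cons j a ih =>
      rw [List.map_cons, List.prod_cons, ← mul_assoc, h, add_mul, smul_mul_assoc, one_mul,
        smul_mul_assoc, mul_assoc]
      refine add_mem (Submodule.smul_mem _ _ ?_) (Submodule.smul_mem _ _ (mul_mem_wickSpan j ih))
      simpa using word_mul_star_word_mem_wickSpan s a []
  have : wickSpan s ≤ (wickSpan s).comap (LinearMap.mulLeft ℂ (star (s i))) := by
    refine Submodule.span_le.2 ?_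
    rintro _ ⟨a, b, rfl⟩
    simpa [mul_assoc] using mul_star_word_mem_wickSpan b (key a)
  exact this hx

lemma mem_wickSpan_of_mem_adjoin {c Q : ι → ι → ℂ}
    (h : ∀ i j, star (s i) * s j = c i j • 1 + Q i j • (s j * star (s i))) {x : A}
    (hx : x ∈ StarAlgebra.adjoin ℂ (Set.range s)) : x ∈ wickSpan s := by
  have key : ∀ y ∈ wickSpan s, x * y ∈ wickSpan s := by
    rw [← StarSubalgebra.mem_toSubalgebra, StarAlgebra.adjoin_toSubalgebra] at hx
    induction hx using Algebra.adjoin_induction with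
    | mem x hx =>
      rcases hx with ⟨i, rfl⟩ | ⟨i, hi⟩
      · exact fun y => mul_mem_wickSpan i
      · rw [← star_star x, ← hi]
        exact fun y => star_mul_mem_wickSpan h i
    | algebraMap r =>
      intro y hy
      rw [← Algebra.smul_def]
      exact Submodule.smul_mem _ _ hy
    | add x y _ _ hx hy => exact fun z hz => by rw [add_mul]; exact add_mem (hx z hz) (hy z hz)
    | mul x y _ _ hx hy => exact fun z hz => by rw [mul_assoc]; exact hx _ (hy z hz)
  simpa using key 1 (by simpa using word_mul_star_word_mem_wickSpan s [] [])

/-- A continuous functional that vanishes on `1`, on products starting with a creator and on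
products ending with an annihilator is zero. -/
lemma eq_zero_of_wick {c Q : ι → ι → ℂ}
    (h : ∀ i j, star (s i) * s j = c i j • 1 + Q i j • (s j * star (s i)))
    (hd : (StarAlgebra.adjoin ℂ (Set.range s)).topologicalClosure = ⊤)
    {φ : A →ₗ[ℂ] ℂ} (hφ : Continuous φ) (h1 : φ 1 = 0) (hl : ∀ i a, φ (s i * a) = 0)
    (hr : ∀ i a, φ (a * star (s i)) = 0) : φ = 0 := by
  have hW : wickSpan s ≤ LinearMap.ker φ := by
    refine Submodule.span_le.2 ?_
    rintro _ ⟨a, b, rfl⟩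
    cases a with
    | cons i a => simpa [mul_assoc] using hl i _
    | nil =>
      cases b with
      | nil => simpa using h1
      | cons i b => simpa using hr i _
  have hcl : IsClosed {x | φ x = 0} := isClosed_eq hφ continuous_const
  ext x
  have hx : x ∈ (StarAlgebra.adjoin ℂ (Set.range s)).topologicalClosure := hd ▸ trivial
  exact closure_minimal (fun y hy => hW (mem_wickSpan_of_mem_adjoin h hy)) hcl hx

end Wick

/-! ### Fock space and creation operators -/

section FockSpace

/-- The full Fock space over the letters `ι` tensored with `G`, as the square summable `G`-valued
functions on words. For `G = ℂ` it is the full Fock space itself. -/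
abbrev FockSpace (ι : Type*) (G : Type*) [NormedAddCommGroup G] : Type _ :=
  lp (fun _ : List ι => G) 2

variable {ι : Type*} {G : Type*} [NormedAddCommGroup G]

lemma summable_norm_sq (f : FockSpace ι G) : Summable fun a => ‖f a‖ ^ 2 := by
  simpa using (lp.memℓp f).summable (by norm_num)

lemma FockSpace.norm_sq_eq (f : FockSpace ι G) : ‖f‖ ^ 2 = ∑' a, ‖f a‖ ^ 2 := by
  simpa using lp.norm_rpow_eq_tsum (p := 2) (by norm_num) f

lemma memℓp_comp_cons (i : ι) (f : FockSpace ι G) : Memℓp (fun a => f (i :: a)) 2 := by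
  refine memℓp_gen ?_
  simpa [Function.comp_def] using
    (summable_norm_sq f).comp_injective (List.cons_injective (a := i))

variable [InnerProductSpace ℂ G]

/-- The annihilation operator of the letter `i`, which removes `i` from the front of a word:
`(Lᵢ* f)(w) = f(i w)`. -/
noncomputable def annihilate (ι : Type*) (G : Type*) [NormedAddCommGroup G]
    [InnerProductSpace ℂ G] (i : ι) : FockSpace ι G →L[ℂ] FockSpace ι G :=
  LinearMap.mkContinuous
    { toFun := fun f => ⟨fun a => f (i :: a), memℓp_comp_cons i f⟩
      map_add' := fun _ _ => rfl
      map_smul' := fun _ _ => rfl } 1 fun f => by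
    rw [one_mul]
    refine le_of_sq_le_sq ?_ (norm_nonneg f)
    rw [FockSpace.norm_sq_eq, FockSpace.norm_sq_eq]
    exact tsum_comp_le_tsum_of_inj (summable_norm_sq f) (fun _ => by positivity)
      (List.cons_injective (a := i))

@[simp] lemma annihilate_apply (i : ι) (f : FockSpace ι G) (a : List ι) :
    annihilate ι G i f a = f (i :: a) := rfl

/-- The creation operator of the letter `i`, defined as the adjoint of the annihilation operator;
see `create_apply_nil` and `create_apply_cons` for its values. -/
noncomputable def create (ι : Type*) (G : Type*) [NormedAddCommGroup G]
    [InnerProductSpace ℂ G] [CompleteSpace G] (i : ι) : FockSpace ι G →L[ℂ] FockSpace ι G :=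
  star (annihilate ι G i)

lemma star_create [CompleteSpace G] (i : ι) : star (create ι G i) = annihilate ι G i :=
  star_star _

variable [DecidableEq ι]

lemma annihilate_single_nil (i : ι) (g : G) : annihilate ι G i (lp.single 2 [] g) = 0 := by
  ext a
  simp [lp.single_apply]

lemma annihilate_single_cons (i j : ι) (a : List ι) (g : G) :
    annihilate ι G i (lp.single 2 (j :: a) g) = if i = j then lp.single 2 a g else 0 := by
  ext b
  by_cases h : i = j
  · subst h
    by_cases hb : b = a
    · simp [hb]
    · rw [if_pos rfl, annihilate_apply, lp.single_apply_ne _ _ _ (by simpa using hb),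
        lp.single_apply_ne _ _ _ hb]
  · rw [if_neg h, annihilate_apply, lp.single_apply_ne _ _ _ (by simp [h])]
    rfl

variable [CompleteSpace G]

lemma inner_create_apply (i : ι) (f : FockSpace ι G) (a : List ι) (g : G) :
    inner ℂ g (create ι G i f a) = inner ℂ (annihilate ι G i (lp.single 2 a g)) f := by
  refine (lp.inner_single_left (𝕜 := ℂ) a g (create ι G i f)).symm.trans ?_
  rw [create, ContinuousLinearMap.star_eq_adjoint, ContinuousLinearMap.adjoint_inner_right]

@[simp] lemma create_apply_nil (i : ι) (f : FockSpace ι G) : create ι G i f [] = 0 := by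
  refine ext_inner_left ℂ fun g => ?_
  rw [inner_create_apply, annihilate_single_nil, inner_zero_left, inner_zero_right]

@[simp] lemma create_apply_cons (i j : ι) (f : FockSpace ι G) (a : List ι) :
    create ι G i f (j :: a) = if i = j then f a else 0 := by
  refine ext_inner_left ℂ fun g => ?_
  rw [inner_create_apply, annihilate_single_cons]
  split_ifs
  · rw [lp.inner_single_left]
  · rw [inner_zero_left, inner_zero_right]

lemma star_create_mul_create (i j : ι) :
    star (create ι G i) * create ι G j = if i = j then 1 else 0 := by
  ext f a
  rw [star_create]
  by_cases h : i = j
  · subst h; simp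
  · simp [h, Ne.symm h]

lemma create_single (i : ι) (a : List ι) (g : G) :
    create ι G i (lp.single 2 a g) = lp.single 2 (i :: a) g := by
  ext b
  cases b with
  | nil => simp [lp.single_apply]
  | cons j b =>
    by_cases h : i = j
    · subst h
      by_cases hb : b = a
      · simp [hb]
      · simp [lp.single_apply, hb]
    · simp [lp.single_apply, h, Ne.symm h]

/-- The vectors at the empty word generate the Fock space under the creation operators. -/
lemma eq_top_of_single_nil_mem {K : Submodule ℂ (FockSpace ι G)}
    (hK : IsClosed (K : Set (FockSpace ι G))) (h0 : ∀ g, lp.single 2 [] g ∈ K)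
    (h : ∀ i, ∀ f ∈ K, create ι G i f ∈ K) : K = ⊤ := by
  have hs : ∀ a g, (lp.single 2 a g : FockSpace ι G) ∈ K := by
    intro a g
    induction a with
    | nil => exact h0 g
    | cons i a ih => exact create_single i a g ▸ h i _ ih
  refine eq_top_iff.2 fun f _ => ?_
  exact hK.mem_of_tendsto (lp.hasSum_single (by norm_num) f)
    (Filter.Eventually.of_forall fun s => sum_mem fun a _ => hs a _)

variable [Fintype ι]

/-- The creation operators on the full Fock space act irreducibly. -/
lemma eq_bot_or_eq_top_of_invariant {K : Submodule ℂ (FockSpace ι ℂ)}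
    (hK : IsClosed (K : Set (FockSpace ι ℂ)))
    (hc : ∀ i, ∀ f ∈ K, create ι ℂ i f ∈ K)
    (ha : ∀ i, ∀ f ∈ K, annihilate ι ℂ i f ∈ K) : K = ⊥ ∨ K = ⊤ := by
  by_cases hb : K = ⊥
  · exact Or.inl hb
  right
  obtain ⟨f, hf, hf0⟩ := K.exists_mem_ne_zero_of_ne_bot hb
  obtain ⟨a, hfa⟩ : ∃ a, f a ≠ 0 := by
    by_contra! h
    exact hf0 (lp.ext (funext h))
  have hshift : ∀ (a : List ι) (f : FockSpace ι ℂ), f ∈ K → f a ≠ 0 → ∃ f' ∈ K, f' [] ≠ 0 := by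
    intro a
    induction a with
    | nil => exact fun f hf h => ⟨f, hf, h⟩
    | cons i a ih => exact fun f hf h => ih _ (ha i f hf) h
  obtain ⟨f', hf', h'⟩ := hshift a f hf hfa
  -- the projection onto the vacuum is `1 - ∑ i, Lᵢ Lᵢ*`
  have hv : f' - ∑ i, create ι ℂ i (annihilate ι ℂ i f') = lp.single 2 [] (f' []) := by
    ext b
    rw [lp.coeFn_sub, Pi.sub_apply, lp.coeFn_sum, Finset.sum_apply]
    cases b with
    | nil => simp
    | cons j b => simp [lp.single_apply]
  have hv' : lp.single 2 [] (f' []) ∈ K :=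
    hv ▸ sub_mem hf' (sum_mem fun i _ => hc i _ (ha i _ hf'))
  refine eq_top_of_single_nil_mem hK (fun g => ?_) hc
  have := K.smul_mem (g / f' []) hv'
  rwa [← lp.single_smul, smul_eq_mul, div_mul_cancel₀ _ h'] at this

end FockSpace

/-! ### The Poisson kernel -/

section PoissonKernel

variable {ι : Type*} [Fintype ι]
  {G : Type*} [NormedAddCommGroup G] [InnerProductSpace ℂ G] [CompleteSpace G]

/-- A Cuntz–Toeplitz family: isometries with pairwise orthogonal ranges. -/
def IsCuntzToeplitz [DecidableEq ι] {A : Type*} [Ring A] [Star A] (T : ι → A) : Prop :=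
  ∀ i j, star (T i) * T j = if i = j then 1 else 0

/-- The sum `∑ Tᵢ Tᵢ*` of the range projections. -/
noncomputable def rangeProj (T : ι → G →L[ℂ] G) : G →L[ℂ] G := ∑ i, T i * star (T i)

/-- The coefficient `r^|w| (1 - r² ∑ Tᵢ Tᵢ*)^(1/2) T_w*` of the Poisson kernel at the word `w`. The
square root is explicit, since `∑ Tᵢ Tᵢ*` is a projection for a Cuntz–Toeplitz family. -/
noncomputable def poissonCoeff (r : ℝ) (T : ι → G →L[ℂ] G) : List ι → G →L[ℂ] G
  | [] => damp (√(1 - r ^ 2)) (rangeProj T)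
  | i :: a => (r : ℂ) • (poissonCoeff r T a * star (T i))

lemma star_rangeProj (T : ι → G →L[ℂ] G) : star (rangeProj T) = rangeProj T := by
  simp [rangeProj]

lemma norm_star_sq_sum (T : ι → G →L[ℂ] G) (h : G) :
    ((∑ i, ‖star (T i) h‖ ^ 2 : ℝ) : ℂ) = inner ℂ h (rangeProj T h) := by
  simp only [rangeProj, sum_apply, inner_sum, Complex.ofReal_sum]
  refine Finset.sum_congr rfl fun i _ => ?_
  rw [mul_apply_eq_comp, ContinuousLinearMap.star_eq_adjoint,
    ← ContinuousLinearMap.adjoint_inner_left, inner_self_eq_norm_sq_to_K]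
  simp

lemma norm_poissonCoeff_cons_sq (r : ℝ) (T : ι → G →L[ℂ] G) (i : ι) (a : List ι) (h : G) :
    ‖poissonCoeff r T (i :: a) h‖ ^ 2 = r ^ 2 * ‖poissonCoeff r T a (star (T i) h)‖ ^ 2 := by
  rw [poissonCoeff, smul_apply, norm_smul, mul_pow, Complex.norm_real, Real.norm_eq_abs, sq_abs,
    mul_apply_eq_comp]

variable [DecidableEq ι] {T : ι → G →L[ℂ] G}

lemma rangeProj_mul (hT : IsCuntzToeplitz T) (j : ι) : rangeProj T * T j = T j := by
  rw [IsCuntzToeplitz] at hT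
  simp [rangeProj, Finset.sum_mul, mul_assoc, hT]

lemma rangeProj_idem (hT : IsCuntzToeplitz T) : rangeProj T * rangeProj T = rangeProj T := by
  conv_lhs => enter [2]; rw [rangeProj]
  rw [Finset.mul_sum]
  simp_rw [← mul_assoc, rangeProj_mul hT]
  rfl

/-- The identity `(1 - r² Q) + r² Q = 1` for `Q = ∑ Tᵢ Tᵢ*`, in terms of norms. It makes the
Poisson kernel isometric by induction on the length of words. -/
lemma norm_damp_sq (hT : IsCuntzToeplitz T) {r : ℝ} (hr : r ^ 2 ≤ 1) (h : G) :
    ‖damp (√(1 - r ^ 2)) (rangeProj T) h‖ ^ 2 + r ^ 2 * ∑ i, ‖star (T i) h‖ ^ 2 = ‖h‖ ^ 2 := by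
  have e : ((‖damp (√(1 - r ^ 2)) (rangeProj T) h‖ ^ 2 : ℝ) : ℂ) =
      inner ℂ h ((damp (√(1 - r ^ 2)) (rangeProj T) * damp (√(1 - r ^ 2)) (rangeProj T)) h) := by
    rw [mul_apply_eq_comp, ← ContinuousLinearMap.adjoint_inner_left,
      ← ContinuousLinearMap.star_eq_adjoint, star_damp _ (star_rangeProj T),
      inner_self_eq_norm_sq_to_K]
    simp
  rw [damp_mul_damp _ _ (rangeProj_idem hT), Real.mul_self_sqrt (by linarith)] at e
  have : ((‖damp (√(1 - r ^ 2)) (rangeProj T) h‖ ^ 2 + r ^ 2 * ∑ i, ‖star (T i) h‖ ^ 2 : ℝ) : ℂ) =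
      ((‖h‖ ^ 2 : ℝ) : ℂ) := by
    rw [Complex.ofReal_add, Complex.ofReal_mul, e, norm_star_sq_sum]
    simp only [damp, add_apply, sub_apply,
      one_apply_eq_self, smul_apply, inner_add_right,
      inner_sub_right, inner_smul_right, inner_self_eq_norm_sq_to_K]
    push_cast
    simp
    ring
  exact_mod_cast this

lemma sum_list_le {f : List ι → ℝ} (hf : ∀ a, 0 ≤ f a) (s : Finset (List ι)) :
    ∑ a ∈ s, f a ≤ f [] + ∑ i, ∑ a ∈ s.preimage (List.cons i) List.cons_injective.injOn,
      f (i :: a) := by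
  have hsub : s ⊆ insert [] (Finset.univ.biUnion fun i =>
      (s.preimage (List.cons i) List.cons_injective.injOn).map
        ⟨List.cons i, List.cons_injective⟩) := by
    intro a ha
    cases a with
    | nil => simp
    | cons i a => simpa using ha
  refine (Finset.sum_le_sum_of_subset_of_nonneg hsub fun _ _ _ => hf _).trans_eq ?_
  rw [Finset.sum_insert (by simp), Finset.sum_biUnion]
  · simp
  · intro i _ j _ hij
    simp only [Function.onFun, Finset.disjoint_left, Finset.mem_map]
    rintro _ ⟨a, _, rfl⟩ ⟨b, _, hb⟩
    exact hij (List.cons.inj hb).1.symm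

/-- A word is empty or consists of a first letter and a remaining word. -/
def unitSumProdListEquiv (ι : Type*) : Unit ⊕ (ι × List ι) ≃ List ι where
  toFun := Sum.elim (fun _ => []) fun x => x.1 :: x.2
  invFun | [] => Sum.inl () | i :: a => Sum.inr (i, a)
  left_inv := by rintro (_ | _) <;> rfl
  right_inv := by rintro (_ | _) <;> rfl

lemma tsum_list {ι : Type*} [Fintype ι] {f : List ι → ℝ} (hf : Summable f) :
    ∑' a, f a = f [] + ∑ i, ∑' a, f (i :: a) := by
  have h2 : Summable fun x : ι × List ι => f (x.1 :: x.2) :=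
    hf.comp_injective (i := fun x : ι × List ι => x.1 :: x.2) fun x y h =>
      Prod.ext (List.cons.inj h).1 (List.cons.inj h).2
  have h := HasSum.sum (f := f ∘ unitSumProdListEquiv ι) (hasSum_unique _) h2.hasSum
  rw [((unitSumProdListEquiv ι).hasSum_iff.1 h).tsum_eq, h2.tsum_prod, tsum_fintype]
  rfl

lemma sum_norm_poissonCoeff_sq_le (hT : IsCuntzToeplitz T) {r : ℝ} (hr : r ^ 2 ≤ 1)
    (s : Finset (List ι)) (h : G) : ∑ a ∈ s, ‖poissonCoeff r T a h‖ ^ 2 ≤ ‖h‖ ^ 2 := by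
  obtain ⟨N, hN⟩ : ∃ N, ∀ a ∈ s, a.length < N :=
    ⟨s.sup List.length + 1, fun a ha => Nat.lt_succ_of_le (Finset.le_sup ha)⟩
  induction N generalizing s h with
  | zero =>
    obtain rfl : s = ∅ := Finset.eq_empty_of_forall_notMem fun a ha => by simpa using hN a ha
    simp
  | succ N ih =>
    refine (sum_list_le (fun _ => by positivity) s).trans ?_
    rw [← norm_damp_sq hT hr h, Finset.mul_sum]
    refine add_le_add le_rfl (Finset.sum_le_sum fun i _ => ?_)
    simp_rw [norm_poissonCoeff_cons_sq, ← Finset.mul_sum]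
    refine mul_le_mul_of_nonneg_left (ih _ _ fun a ha => ?_) (by positivity)
    simpa using hN _ (Finset.mem_preimage.1 ha)

lemma summable_norm_poissonCoeff_sq (hT : IsCuntzToeplitz T) {r : ℝ} (hr : r ^ 2 ≤ 1) (h : G) :
    Summable fun a => ‖poissonCoeff r T a h‖ ^ 2 :=
  summable_of_sum_le (fun _ => by positivity) fun s => sum_norm_poissonCoeff_sq_le hT hr s h

/-- The Poisson kernel is isometric: the defect `‖h‖² - ∑ ‖K_w h‖²` equals `r²` times the sum of the
defects at the `Tᵢ* h`, so that it is at most `r²ⁿ ‖h‖²` for every `n`. -/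
lemma tsum_norm_poissonCoeff_sq (hT : IsCuntzToeplitz T) {r : ℝ} (hr : r ^ 2 < 1) (h : G) :
    ∑' a, ‖poissonCoeff r T a h‖ ^ 2 = ‖h‖ ^ 2 := by
  have hs := summable_norm_poissonCoeff_sq hT hr.le
  refine le_antisymm
    ((hs h).tsum_le_of_sum_le fun s => sum_norm_poissonCoeff_sq_le hT hr.le s h) ?_
  have hrec : ∀ h, ∑' a, ‖poissonCoeff r T a h‖ ^ 2 = ‖h‖ ^ 2 - r ^ 2 * ∑ i,
      (‖star (T i) h‖ ^ 2 - ∑' a, ‖poissonCoeff r T a (star (T i) h)‖ ^ 2) := by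
    intro h
    rw [tsum_list (hs h)]
    simp_rw [norm_poissonCoeff_cons_sq, tsum_mul_left, ← Finset.mul_sum]
    rw [Finset.sum_sub_distrib, ← norm_damp_sq hT hr.le h, poissonCoeff]
    ring
  -- `norm_damp_sq` at `r = 1`
  have hle : ∀ h, ∑ i, ‖star (T i) h‖ ^ 2 ≤ ‖h‖ ^ 2 := fun h => by
    have := norm_damp_sq hT (r := 1) (by norm_num) h
    nlinarith [sq_nonneg ‖damp (√(1 - 1 ^ 2)) (rangeProj T) h‖]
  have hdefect : ∀ n : ℕ, ∀ h,
      ‖h‖ ^ 2 - ∑' a, ‖poissonCoeff r T a h‖ ^ 2 ≤ (r ^ 2) ^ n * ‖h‖ ^ 2 := by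
    intro n
    induction n with
    | zero =>
      intro h
      have : 0 ≤ ∑' a, ‖poissonCoeff r T a h‖ ^ 2 := tsum_nonneg fun _ => by positivity
      simpa using this
    | succ n ih =>
      intro h
      rw [hrec, sub_sub_cancel, pow_succ' (r ^ 2), mul_assoc]
      refine mul_le_mul_of_nonneg_left ((Finset.sum_le_sum fun i _ => ih _).trans ?_)
        (sq_nonneg r)
      rw [← Finset.mul_sum]
      exact mul_le_mul_of_nonneg_left (hle h) (by positivity)
  have hlim : Filter.Tendsto (fun n : ℕ => (r ^ 2) ^ n * ‖h‖ ^ 2) Filter.atTop (nhds 0) := by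
    simpa using (tendsto_pow_atTop_nhds_zero_of_lt_one (sq_nonneg r) hr).mul_const (‖h‖ ^ 2)
  exact sub_nonpos.1 (ge_of_tendsto' hlim fun n => hdefect n h)

/-- The Poisson kernel of a Cuntz–Toeplitz family, an isometry into the Fock space. -/
noncomputable def poissonKernel (hT : IsCuntzToeplitz T) {r : ℝ} (hr : r ^ 2 < 1) :
    G →ₗᵢ[ℂ] FockSpace ι G where
  toFun h := ⟨fun a => poissonCoeff r T a h, memℓp_gen <| by
    simpa using summable_norm_poissonCoeff_sq hT hr.le h⟩
  map_add' _ _ := lp.ext <| funext fun _ => map_add _ _ _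
  map_smul' _ _ := lp.ext <| funext fun _ => map_smul _ _ _
  norm_map' h := by
    rw [← sq_eq_sq₀ (norm_nonneg _) (norm_nonneg _), FockSpace.norm_sq_eq]
    exact tsum_norm_poissonCoeff_sq hT hr h

lemma annihilate_poissonKernel (hT : IsCuntzToeplitz T) {r : ℝ} (hr : r ^ 2 < 1) (i : ι) (h : G) :
    annihilate ι G i (poissonKernel hT hr h) = (r : ℂ) • poissonKernel hT hr (star (T i) h) :=
  rfl

/-- The Poisson kernel intertwines `T i` with `r` times the creation operator, up to an error at the
empty word that is small for `r` close to `1`, because `1 - r² ∑ Tⱼ Tⱼ*` is `1 - r²` on the range of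
`T i`. -/
lemma poissonKernel_apply_range (hT : IsCuntzToeplitz T) {r : ℝ} (hr : r ^ 2 < 1) (i : ι) (h : G) :
    poissonKernel hT hr (T i h) = (r : ℂ) • create ι G i (poissonKernel hT hr h) +
      lp.single 2 [] ((√(1 - r ^ 2) : ℂ) • T i h) := by
  ext a
  change poissonCoeff r T a (T i h) = (r : ℂ) • create ι G i (poissonKernel hT hr h) a +
    (lp.single 2 [] ((√(1 - r ^ 2) : ℂ) • T i h) : FockSpace ι G) a
  cases a with
  | nil =>
    have h1 : rangeProj T (T i h) = T i h := congrArg (· h) (rangeProj_mul hT i)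
    simp [poissonCoeff, damp, h1]
  | cons j a =>
    have h1 : star (T j) (T i h) = if i = j then h else 0 := by
      have := congrArg (· h) (hT j i)
      by_cases hij : i = j
      · subst hij; simpa using this
      · simpa [hij, Ne.symm hij] using this
    rw [poissonCoeff, smul_apply, mul_apply_eq_comp, h1, create_apply_cons,
      lp.single_apply_ne _ _ _ (List.cons_ne_nil j a), add_zero]
    split_ifs
    · rfl
    · rw [map_zero]

lemma norm_apply_le_of_star_mul_self {S : G →L[ℂ] G} (hS : star S * S = 1) (h : G) :
    ‖S h‖ ≤ ‖h‖ :=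
  (S.le_of_opNorm_le (norm_le_one_of_star_mul_self hS) h).trans_eq (one_mul _)

lemma norm_star_apply_le_of_star_mul_self {S : G →L[ℂ] G} (hS : star S * S = 1) (h : G) :
    ‖star S h‖ ≤ ‖h‖ :=
  ((star S).le_of_opNorm_le ((norm_star S).trans_le (norm_le_one_of_star_mul_self hS)) h).trans_eq
    (one_mul _)

/-- Every Cuntz–Toeplitz family is, up to `ε`, the compression of the creation operators to an
almost reducing subspace. -/
lemma exists_asymptotic_intertwiner (hT : IsCuntzToeplitz T) {ε : ℝ} (hε : 0 < ε) :
    ∃ K : G →L[ℂ] FockSpace ι G, (∀ h, ‖K h‖ = ‖h‖) ∧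
      (∀ i, ‖create ι G i ∘L K - K ∘L T i‖ ≤ ε) ∧
      ∀ i, ‖annihilate ι G i ∘L K - K ∘L star (T i)‖ ≤ ε := by
  obtain ⟨r, hr0, hr1, hrε⟩ : ∃ r : ℝ, 0 ≤ r ∧ r < 1 ∧ (1 - r) + √(1 - r ^ 2) < ε := by
    have hc : Continuous fun r : ℝ => (1 - r) + √(1 - r ^ 2) := by fun_prop
    have h1 : ∀ᶠ r in nhdsWithin (1 : ℝ) (Set.Iio 1), (1 - r) + √(1 - r ^ 2) < ε :=
      (hc.tendsto 1).eventually_lt_const (by simpa using hε) |>.filter_mono nhdsWithin_le_nhds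
    have h2 : ∀ᶠ r in nhdsWithin (1 : ℝ) (Set.Iio 1), 0 ≤ r :=
      (eventually_ge_nhds zero_lt_one).filter_mono nhdsWithin_le_nhds
    obtain ⟨r, ⟨hr, hr0⟩, hr1⟩ := ((h1.and h2).and self_mem_nhdsWithin).exists
    exact ⟨r, hr0, hr1, hr⟩
  have hr : r ^ 2 < 1 := by nlinarith
  have hT1 : ∀ i, star (T i) * T i = 1 := fun i => (hT i i).trans (if_pos rfl)
  have hL1 : ∀ i, star (create ι G i) * create ι G i = 1 := fun i =>
    (star_create_mul_create i i).trans (if_pos rfl)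
  obtain ⟨K, hK, hK'⟩ : ∃ K : G →ₗᵢ[ℂ] FockSpace ι G,
      (∀ i h, annihilate ι G i (K h) = (r : ℂ) • K (star (T i) h)) ∧
      ∀ i h, K (T i h) = (r : ℂ) • create ι G i (K h) +
        lp.single 2 [] ((√(1 - r ^ 2) : ℂ) • T i h) :=
    ⟨poissonKernel hT hr, annihilate_poissonKernel hT hr, poissonKernel_apply_range hT hr⟩
  have hs := Real.sqrt_nonneg (1 - r ^ 2)
  have hnr : ‖(1 - r : ℂ)‖ = 1 - r := by
    rw [← Complex.ofReal_one, ← Complex.ofReal_sub, Complex.norm_real, Real.norm_of_nonneg]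
    linarith
  refine ⟨K.toContinuousLinearMap, K.norm_map, fun i => ?_, fun i => ?_⟩
  · refine ContinuousLinearMap.opNorm_le_bound _ hε.le fun h => ?_
    have e : (create ι G i ∘L K.toContinuousLinearMap - K.toContinuousLinearMap ∘L T i) h =
        (1 - r : ℂ) • create ι G i (K h) - lp.single 2 [] ((√(1 - r ^ 2) : ℂ) • T i h) := by
      change create ι G i (K h) - K (T i h) = _
      rw [hK']
      module
    rw [e]
    refine (norm_sub_le _ _).trans ?_
    rw [norm_smul, lp.norm_single (by norm_num), norm_smul, Complex.norm_real,
      Real.norm_of_nonneg hs, hnr]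
    have h1 := (norm_apply_le_of_star_mul_self (hL1 i) (K h)).trans_eq (K.norm_map h)
    have h2 := norm_apply_le_of_star_mul_self (hT1 i) h
    have := norm_nonneg h
    nlinarith
  · refine ContinuousLinearMap.opNorm_le_bound _ hε.le fun h => ?_
    have e : (annihilate ι G i ∘L K.toContinuousLinearMap -
        K.toContinuousLinearMap ∘L star (T i)) h = -((1 - r : ℂ) • K (star (T i) h)) := by
      change annihilate ι G i (K h) - K (star (T i) h) = _
      rw [hK]
      module
    rw [e, norm_neg, norm_smul, hnr, K.norm_map]
    have h2 := norm_star_apply_le_of_star_mul_self (hT1 i) h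
    have := norm_nonneg h
    nlinarith

end PoissonKernel

/-! ### Asymptotic intertwining -/

section Intertwining

variable {A : Type*} [CStarAlgebra A]
  {G : Type*} [NormedAddCommGroup G] [InnerProductSpace ℂ G] [CompleteSpace G]
  {F : Type*} [NormedAddCommGroup F] [InnerProductSpace ℂ F] [CompleteSpace F]

lemma norm_intertwining_le (σ : A →⋆ₐ[ℂ] (F →L[ℂ] F)) (τ : A →⋆ₐ[ℂ] (G →L[ℂ] G))
    {K : G →L[ℂ] F} (hK : ‖K‖ ≤ 1) (a : A) : ‖σ a ∘L K - K ∘L τ a‖ ≤ 2 * ‖a‖ := by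
  have h1 : ‖σ a ∘L K‖ ≤ ‖a‖ * 1 := ((σ a).opNorm_comp_le K).trans
    (mul_le_mul (NonUnitalStarAlgHom.norm_apply_le σ a) hK (norm_nonneg _) (norm_nonneg _))
  have h2 : ‖K ∘L τ a‖ ≤ 1 * ‖a‖ := (K.opNorm_comp_le (τ a)).trans
    (mul_le_mul hK (NonUnitalStarAlgHom.norm_apply_le τ a) (norm_nonneg _) zero_le_one)
  linarith [norm_sub_le (σ a ∘L K) (K ∘L τ a)]

/-- The elements `a` for which the operators `K n` asymptotically intertwine `σ a` and `τ a`, in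
operator norm. -/
def asymptoticIntertwined (σ : A →⋆ₐ[ℂ] (F →L[ℂ] F)) (τ : A →⋆ₐ[ℂ] (G →L[ℂ] G))
    (K : ℕ → G →L[ℂ] F) : Subalgebra ℂ A where
  carrier := {a | Tendsto (fun n => σ a ∘L K n - K n ∘L τ a) atTop (𝓝 0)}
  mul_mem' {a b} ha hb := by
    have h1 : Tendsto (fun n => σ a ∘L (σ b ∘L K n - K n ∘L τ b)) atTop (𝓝 0) := by
      have := ((ContinuousLinearMap.compL ℂ G F F (σ a)).continuous.tendsto 0).comp hb
      rwa [map_zero] at this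
    have h2 : Tendsto (fun n => (σ a ∘L K n - K n ∘L τ a) ∘L τ b) atTop (𝓝 0) := by
      have := (((ContinuousLinearMap.compL ℂ G G F).flip (τ b)).continuous.tendsto 0).comp ha
      rwa [map_zero] at this
    have h := h1.add h2
    rw [add_zero] at h
    refine h.congr fun n => ?_
    ext x
    simp
  add_mem' {a b} ha hb := by
    have h := Tendsto.add ha hb
    rw [add_zero] at h
    refine h.congr fun n => ?_
    ext x
    simp
    abel
  algebraMap_mem' r := by
    refine tendsto_const_nhds.congr fun n => ?_
    ext x
    simp [Algebra.algebraMap_eq_smul_one]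

lemma isClosed_asymptoticIntertwined (σ : A →⋆ₐ[ℂ] (F →L[ℂ] F)) (τ : A →⋆ₐ[ℂ] (G →L[ℂ] G))
    {K : ℕ → G →L[ℂ] F} (hK : ∀ n, ‖K n‖ ≤ 1) :
    IsClosed (asymptoticIntertwined σ τ K : Set A) := by
  refine isClosed_of_closure_subset fun a ha => ?_
  refine Metric.tendsto_atTop.2 fun ε hε => ?_
  obtain ⟨b, hb, hab⟩ := Metric.mem_closure_iff.1 ha (ε / 4) (by positivity)
  obtain ⟨N, hN⟩ := Metric.tendsto_atTop.1 hb (ε / 2) (by positivity)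
  refine ⟨N, fun n hn => ?_⟩
  have h1 := hN n hn
  have h2 := norm_intertwining_le σ τ (hK n) (a - b)
  have e : σ a ∘L K n - K n ∘L τ a =
      (σ (a - b) ∘L K n - K n ∘L τ (a - b)) + (σ b ∘L K n - K n ∘L τ b) := by
    ext x
    simp
    abel
  rw [dist_zero_right] at h1 ⊢
  rw [dist_eq_norm] at hab
  rw [e]
  linarith [norm_add_le (σ (a - b) ∘L K n - K n ∘L τ (a - b)) (σ b ∘L K n - K n ∘L τ b)]

end Intertwining

/-! ### Irreducible representations -/

section Irreducible

variable {A : Type*} [CStarAlgebra A]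
  {H : Type*} [NormedAddCommGroup H] [InnerProductSpace ℂ H] [CompleteSpace H]

/-- The linear map `a ↦ π(a) x` onto the orbit of a vector. -/
noncomputable def orbitMap (π : A →⋆ₐ[ℂ] (H →L[ℂ] H)) (x : H) : A →ₗ[ℂ] H where
  toFun a := π a x
  map_add' a b := by simp
  map_smul' c a := by simp

@[simp] lemma orbitMap_apply (π : A →⋆ₐ[ℂ] (H →L[ℂ] H)) (x : H) (a : A) :
    orbitMap π x a = π a x := rfl

lemma continuous_orbitMap (π : A →⋆ₐ[ℂ] (H →L[ℂ] H)) (x : H) : Continuous (orbitMap π x) :=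
  AddMonoidHomClass.continuous_of_bound (orbitMap π x) ‖x‖ fun a => by
    rw [mul_comm]
    exact (π a).le_of_opNorm_le (NonUnitalStarAlgHom.norm_apply_le π a) x

/-- Every nonzero vector is cyclic for an irreducible representation. -/
lemma IsIrreducibleRep.denseRange_orbitMap {π : A →⋆ₐ[ℂ] (H →L[ℂ] H)} (h : IsIrreducibleRep π)
    {x : H} (hx : x ≠ 0) : DenseRange (orbitMap π x) := by
  set K := (LinearMap.range (orbitMap π x)).topologicalClosure
  have hK : IsClosed (K : Set H) := Submodule.isClosed_topologicalClosure _
  have hinv : ∀ a : A, ∀ y ∈ K, π a y ∈ K := by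
    intro a y hy
    have hcl : IsClosed {y | π a y ∈ K} := hK.preimage (π a).continuous
    refine closure_minimal ?_ hcl hy
    rintro _ ⟨b, rfl⟩
    refine Submodule.le_topologicalClosure _ ⟨a * b, ?_⟩
    simp
  rcases h.2 K hK hinv with h0 | h1
  · have : x ∈ K := Submodule.le_topologicalClosure _ ⟨1, by simp⟩
    rw [h0, Submodule.mem_bot] at this
    exact absurd this hx
  · intro y
    have : y ∈ K := h1 ▸ trivial
    exact this

lemma IsIrreducibleRep.conj {H' : Type*} [NormedAddCommGroup H'] [InnerProductSpace ℂ H']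
    [CompleteSpace H'] {π : A →⋆ₐ[ℂ] (H →L[ℂ] H)} (h : IsIrreducibleRep π) (e : H ≃ₗᵢ[ℂ] H') :
    IsIrreducibleRep (e.conjStarAlgEquiv.toStarAlgHom.comp π) := by
  have := h.1
  refine ⟨e.symm.toEquiv.nontrivial, fun K hK hinv => ?_⟩
  have hs : Function.Surjective e.toLinearEquiv.toLinearMap := e.surjective
  rcases h.2 (K.comap e.toLinearEquiv.toLinearMap) (hK.preimage e.continuous) (fun a x hx => by
      simpa using hinv a (e x) hx) with h | h
  · left
    exact Submodule.comap_injective_of_surjective hs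
      (h.trans (LinearMap.ker_eq_bot.2 e.injective).symm)
  · right
    exact Submodule.comap_injective_of_surjective hs (h.trans (Submodule.comap_top _).symm)

end Irreducible

/-! ### Vacuum vectors and uniqueness -/

section Vacuum

variable {q : ℂ}
  {H : Type*} [NormedAddCommGroup H] [InnerProductSpace ℂ H] [CompleteSpace H]
  {M : Type*} [NormedAddCommGroup M] [InnerProductSpace ℂ M] [CompleteSpace M]

/-- The generators of `O₂^q` as a family. -/
noncomputable def gen (q : ℂ) : Fin 2 → O₂.{u} q := ![O₂.s₁ q, O₂.s₂ q]

/-- The defining relations in the form used for Wick ordering. -/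
lemma gen_wick (q : ℂ) (i j : Fin 2) : star (gen.{u} q i) * gen q j =
    (1 : Matrix (Fin 2) (Fin 2) ℂ) i j • 1 +
      !![0, q; star q, 0] i j • (gen q j * star (gen q i)) := by
  have h21 : star (O₂.s₂.{u} q) * O₂.s₁ q = star q • (O₂.s₁ q * star (O₂.s₂ q)) := by
    simpa using congrArg star (O₂.s_rel.{u} q)
  fin_cases i <;> fin_cases j <;>
    simp [gen, O₂.s₁_isometry, O₂.s₂_isometry, O₂.s_rel, h21]

lemma gen_dense (q : ℂ) :
    (StarAlgebra.adjoin ℂ (Set.range (gen.{u} q))).topologicalClosure = ⊤ := by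
  rw [gen, Matrix.range_cons, Matrix.range_cons, Matrix.range_empty, Set.union_empty,
    Set.singleton_union]
  exact O₂.dense_adjoin q

/-- A vacuum vector, possibly zero: the adjoints of both generators annihilate it. -/
def IsVacuum (π : O₂.{u} q →⋆ₐ[ℂ] (H →L[ℂ] H)) (Ω : H) : Prop :=
  ∀ i, star (π (gen q i)) Ω = 0

lemma isVacuum_iff {π : O₂.{u} q →⋆ₐ[ℂ] (H →L[ℂ] H)} {Ω : H} :
    IsVacuum π Ω ↔ star (π (O₂.s₁ q)) Ω = 0 ∧ star (π (O₂.s₂ q)) Ω = 0 := by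
  simp [IsVacuum, Fin.forall_fin_two, gen]

lemma IsVacuum.inner_gen_mul {π : O₂.{u} q →⋆ₐ[ℂ] (H →L[ℂ] H)} {Ω : H} (h : IsVacuum π Ω)
    (i : Fin 2) (a : O₂.{u} q) : inner ℂ Ω (π (gen q i * a) Ω) = 0 := by
  rw [map_mul, mul_apply_eq_comp, ← ContinuousLinearMap.adjoint_inner_left,
    ← ContinuousLinearMap.star_eq_adjoint, h i, inner_zero_left]

lemma IsVacuum.inner_mul_star_gen {π : O₂.{u} q →⋆ₐ[ℂ] (H →L[ℂ] H)} {Ω : H} (h : IsVacuum π Ω)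
    (i : Fin 2) (a : O₂.{u} q) : inner ℂ Ω (π (a * star (gen q i)) Ω) = 0 := by
  rw [map_mul, map_star π, mul_apply_eq_comp, h i, map_zero, inner_zero_right]

lemma inner_map_star_mul_self (π : O₂.{u} q →⋆ₐ[ℂ] (H →L[ℂ] H)) (x : H) (a : O₂.{u} q) :
    inner ℂ x (π (star a * a) x) = ((‖π a x‖ ^ 2 : ℝ) : ℂ) := by
  rw [map_mul, map_star π, mul_apply_eq_comp, ContinuousLinearMap.star_eq_adjoint,
    ContinuousLinearMap.adjoint_inner_right, inner_self_eq_norm_sq_to_K]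
  simp

/-- All vacuum vectors define the same functional on `O₂^q` up to scale, so the norms on their
orbits are proportional. -/
lemma IsVacuum.norm_mul_norm_eq {π : O₂.{u} q →⋆ₐ[ℂ] (H →L[ℂ] H)}
    {σ : O₂.{u} q →⋆ₐ[ℂ] (M →L[ℂ] M)} {Ω : H} {ξ : M} (hΩ : IsVacuum π Ω) (hξ : IsVacuum σ ξ)
    (a : O₂.{u} q) : ‖π a Ω‖ * ‖ξ‖ = ‖σ a ξ‖ * ‖Ω‖ := by
  let φ : O₂.{u} q →ₗ[ℂ] ℂ :=
    ((‖ξ‖ ^ 2 : ℝ) : ℂ) • ((innerSL ℂ Ω).toLinearMap ∘ₗ orbitMap π Ω) -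
      ((‖Ω‖ ^ 2 : ℝ) : ℂ) • ((innerSL ℂ ξ).toLinearMap ∘ₗ orbitMap σ ξ)
  have hφ : ∀ a, φ a = ((‖ξ‖ ^ 2 : ℝ) : ℂ) * inner ℂ Ω (π a Ω) -
      ((‖Ω‖ ^ 2 : ℝ) : ℂ) * inner ℂ ξ (σ a ξ) := fun _ => rfl
  have hcπ : Continuous fun a => π a Ω := continuous_orbitMap π Ω
  have hcσ : Continuous fun a => σ a ξ := continuous_orbitMap σ ξ
  have h0 : φ = 0 := by
    refine eq_zero_of_wick (gen_wick q) (gen_dense q) ?_ ?_ (fun i a => ?_) fun i a => ?_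
    · change Continuous fun a => ((‖ξ‖ ^ 2 : ℝ) : ℂ) * inner ℂ Ω (π a Ω) -
        ((‖Ω‖ ^ 2 : ℝ) : ℂ) * inner ℂ ξ (σ a ξ)
      fun_prop
    · rw [hφ, map_one, map_one, one_apply_eq_self, one_apply_eq_self, inner_self_eq_norm_sq_to_K,
        inner_self_eq_norm_sq_to_K]
      simp
      ring
    · rw [hφ, hΩ.inner_gen_mul, hξ.inner_gen_mul]
      ring
    · rw [hφ, hΩ.inner_mul_star_gen, hξ.inner_mul_star_gen]
      ring
  -- `⟪Ω, π(a* a) Ω⟫ = ‖π(a) Ω‖²`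
  have h := hφ (star a * a)
  rw [h0, LinearMap.zero_apply, inner_map_star_mul_self, inner_map_star_mul_self] at h
  have h' : ‖ξ‖ ^ 2 * ‖π a Ω‖ ^ 2 = ‖Ω‖ ^ 2 * ‖σ a ξ‖ ^ 2 := by
    exact_mod_cast sub_eq_zero.1 h.symm
  refine (sq_eq_sq₀ (by positivity) (by positivity)).1 ?_
  rw [mul_pow, mul_pow, mul_comm, h', mul_comm]

lemma IsFockRep.conj {π : O₂.{u} q →⋆ₐ[ℂ] (H →L[ℂ] H)} (hπ : IsFockRep π) (e : H ≃ₗᵢ[ℂ] M) :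
    IsFockRep (e.conjStarAlgEquiv.toStarAlgHom.comp π) := by
  obtain ⟨hirr, Ω, hΩ0, h₁, h₂⟩ := hπ
  refine ⟨hirr.conj e, e Ω, by simpa using hΩ0, ?_, ?_⟩
  · change star (e.conjStarAlgEquiv (π (O₂.s₁ q))) (e Ω) = 0
    rw [← map_star e.conjStarAlgEquiv]
    simp [h₁]
  · change star (e.conjStarAlgEquiv (π (O₂.s₂ q))) (e Ω) = 0
    rw [← map_star e.conjStarAlgEquiv]
    simp [h₂]

lemma IsFockRep.exists_unitary {π : O₂.{u} q →⋆ₐ[ℂ] (H →L[ℂ] H)}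
    {ρ : O₂.{u} q →⋆ₐ[ℂ] (M →L[ℂ] M)} (hπ : IsFockRep π) (hρ : IsFockRep ρ) :
    ∃ U : H ≃ₗᵢ[ℂ] M, ∀ (a : O₂.{u} q) (x : H), U (π a x) = ρ a (U x) := by
  obtain ⟨hπ, Ω, hΩ0, hΩ⟩ := hπ
  obtain ⟨hρ, ξ, hξ0, hξ⟩ := hρ
  rw [← isVacuum_iff] at hΩ hξ
  have hΩn := norm_ne_zero_iff.2 hΩ0
  have hξn := norm_ne_zero_iff.2 hξ0
  -- the second vacuum, scaled to the norm of the first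
  set ξ' : M := ((‖Ω‖ / ‖ξ‖ : ℝ) : ℂ) • ξ with hξ'
  have hξ'0 : ξ' ≠ 0 := smul_ne_zero (by simp [hΩ0, hξ0]) hξ0
  have hnorm : ∀ a : O₂.{u} q, ‖orbitMap ρ ξ' (LinearEquiv.refl ℂ _ a)‖ = ‖orbitMap π Ω a‖ := by
    intro a
    have := hΩ.norm_mul_norm_eq hξ a
    simp only [LinearEquiv.refl_apply, orbitMap_apply, hξ', map_smul, norm_smul,
      Complex.norm_real, Real.norm_eq_abs, abs_div, abs_norm]
    field_simp
    linarith
  have hd := hπ.denseRange_orbitMap hΩ0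
  let U := (LinearEquiv.refl ℂ (O₂.{u} q)).extendOfIsometry (orbitMap π Ω) (orbitMap ρ ξ') hd
    (hρ.denseRange_orbitMap hξ'0) hnorm
  have hU : ∀ a, U (π a Ω) = ρ a ξ' := fun a => LinearEquiv.extendOfIsometry_eq _ _ _ _ _ _ a
  refine ⟨U, fun a x => ?_⟩
  refine hd.induction_on x (isClosed_eq (by fun_prop) (by fun_prop)) fun b => ?_
  rw [orbitMap_apply, hU, ← mul_apply_eq_comp, ← map_mul, hU, map_mul, mul_apply_eq_comp]

end Vacuum

/-! ### Representations by creation operators and faithfulness -/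

section FockRepresentation

variable {q : ℂ}

/-- The generators of `O₂^q` with orthogonal ranges: `s₁` and the part of `s₂` orthogonal to it. -/
noncomputable def orthGen (q : ℂ) : Fin 2 → O₂.{u} q :=
  ![O₂.s₁ q, orthPart q (O₂.s₁ q) (O₂.s₂ q)]

lemma isCuntzToeplitz_orthGen (hq : ‖q‖ < 1) : IsCuntzToeplitz (orthGen.{u} q) := by
  have h1 := star_mul_orthPart q (O₂.s₂.{u} q) (O₂.s₁_isometry q)
  have h2 : star (orthPart q (O₂.s₁ q) (O₂.s₂.{u} q)) * O₂.s₁ q = 0 := by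
    simpa using congrArg star h1
  intro i j
  fin_cases i <;> fin_cases j <;>
    simp [orthGen, O₂.s₁_isometry, h1, h2,
      star_orthPart_mul_self hq (O₂.s₁_isometry q) (O₂.s₂_isometry q) (O₂.s_rel q)]

lemma IsCuntzToeplitz.map {A B ι : Type*} [DecidableEq ι] [CStarAlgebra A] [CStarAlgebra B]
    {T : ι → A} (hT : IsCuntzToeplitz T) (f : A →⋆ₐ[ℂ] B) : IsCuntzToeplitz fun i => f (T i) := by
  intro i j
  have := congrArg f (hT i j)
  rwa [map_mul, map_star f, apply_ite f, map_one, map_zero] at this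

/-- The generators with orthogonal ranges generate `O₂^q`. -/
lemma eq_top_of_orthGen_mem (hq : ‖q‖ < 1) {B : Subalgebra ℂ (O₂.{u} q)}
    (hB : IsClosed (B : Set (O₂.{u} q))) (h : ∀ i, orthGen q i ∈ B)
    (h' : ∀ i, star (orthGen q i) ∈ B) : B = ⊤ := by
  set s₁ := O₂.s₁.{u} q
  set s₂ := O₂.s₂.{u} q
  have h₁ : s₁ ∈ B := h 0
  have h₁' : star s₁ ∈ B := h' 0
  have hn : ‖s₁‖ ≤ 1 := norm_le_one_of_star_mul_self (O₂.s₁_isometry q)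
  have hn' : ‖star s₁‖ ≤ 1 := by rwa [norm_star]
  have hp := B.mul_mem h₁ h₁'
  have hps : star (s₁ * star s₁) = s₁ * star s₁ := by simp
  have hD : damp (damping q) (s₁ * star s₁) ∈ B :=
    B.add_mem (B.sub_mem B.one_mem hp) (B.smul_mem hp _)
  have e : s₂ = orthPart q s₁ s₂ * damp (damping q) (s₁ * star s₁) + q • (s₁ * s₂ * star s₁) :=
    eq_orthPart_add hq (O₂.s₁_isometry q) (O₂.s_rel q)
  have e' : star s₂ = damp (damping q) (s₁ * star s₁) * star (orthPart q s₁ s₂) +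
      star q • (s₁ * star s₂ * star s₁) := by
    conv_lhs => rw [e]
    simp [star_damp _ hps, mul_assoc]
  have h₂ : s₂ ∈ B := mem_of_conj_fixed hq hn hn' e hB h₁ h₁' (B.mul_mem (h 1) hD)
  have h₂' : star s₂ ∈ B :=
    mem_of_conj_fixed (by rwa [norm_star]) hn hn' e' hB h₁ h₁' (B.mul_mem hD (h' 1))
  have hle : (StarAlgebra.adjoin ℂ {s₁, s₂}).toSubalgebra ≤ B := by
    rw [StarAlgebra.adjoin_toSubalgebra, Algebra.adjoin_le_iff]
    rintro x (hx | hx)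
    · rcases hx with rfl | rfl
      exacts [h₁, h₂]
    · rw [← star_star x]
      rcases Set.mem_star.1 hx with hx | hx <;> rw [hx]
      exacts [h₁', h₂']
  refine eq_top_iff.2 fun x _ => ?_
  have hx : x ∈ (StarAlgebra.adjoin ℂ {s₁, s₂}).topologicalClosure :=
    O₂.dense_adjoin q ▸ trivial
  exact closure_minimal hle hB hx

variable {G : Type*} [NormedAddCommGroup G] [InnerProductSpace ℂ G] [CompleteSpace G]

/-- The representation in which the generators with orthogonal ranges act as the creation operators
of the Fock space over two letters, tensored with `G`. -/
def IsFockAction (σ : O₂.{u} q →⋆ₐ[ℂ] (FockSpace (Fin 2) G →L[ℂ] FockSpace (Fin 2) G)) : Prop :=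
  ∀ i, σ (orthGen q i) = create (Fin 2) G i

lemma exists_fock_pair (hq : ‖q‖ < 1) :
    ∃ S₂ : FockSpace (Fin 2) G →L[ℂ] FockSpace (Fin 2) G, star S₂ * S₂ = 1 ∧
      star (create (Fin 2) G 0) * S₂ = q • (S₂ * star (create (Fin 2) G 0)) ∧
      orthPart q (create (Fin 2) G 0) S₂ = create (Fin 2) G 1 :=
  exists_pair_of_orthogonal hq (star_create_mul_create 0 0) (star_create_mul_create 1 1)
    (star_create_mul_create 0 1)

lemma isFockAction_of {σ : O₂.{u} q →⋆ₐ[ℂ] (FockSpace (Fin 2) G →L[ℂ] FockSpace (Fin 2) G)}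
    (h₁ : σ (O₂.s₁ q) = create (Fin 2) G 0)
    (h₂ : orthPart q (create (Fin 2) G 0) (σ (O₂.s₂ q)) = create (Fin 2) G 1) :
    IsFockAction σ := by
  intro i
  fin_cases i
  · exact h₁
  · change σ (orthPart q _ _) = _
    rw [map_orthPart, h₁]
    exact h₂

lemma IsFockAction.apply_star {σ : O₂.{u} q →⋆ₐ[ℂ] (FockSpace (Fin 2) G →L[ℂ] FockSpace (Fin 2) G)}
    (hσ : IsFockAction σ) (i : Fin 2) : σ (star (orthGen q i)) = annihilate (Fin 2) G i := by
  rw [map_star σ, hσ, star_create]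

lemma IsFockAction.isVacuum (hq : ‖q‖ < 1)
    {σ : O₂.{u} q →⋆ₐ[ℂ] (FockSpace (Fin 2) G →L[ℂ] FockSpace (Fin 2) G)}
    (hσ : IsFockAction σ) (g : G) : IsVacuum σ (lp.single 2 [] g) := by
  have h1 : σ (star (O₂.s₁ q)) = annihilate (Fin 2) G 0 := hσ.apply_star 0
  have h2 : σ (star (orthPart q (O₂.s₁ q) (O₂.s₂ q))) = annihilate (Fin 2) G 1 :=
    hσ.apply_star 1
  rw [isVacuum_iff, ← map_star σ, ← map_star σ, h1]
  refine ⟨annihilate_single_nil 0 g, ?_⟩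
  have e := congrArg star (eq_orthPart_add hq (O₂.s₁_isometry.{u} q) (O₂.s_rel q))
  rw [star_add, star_smul, star_mul, star_mul, star_mul, star_star] at e
  rw [e, map_add, map_smul, map_mul, map_mul, h2, map_mul, h1]
  simp [annihilate_single_nil]

lemma IsFockAction.isFockRep (hq : ‖q‖ < 1)
    {σ : O₂.{u} q →⋆ₐ[ℂ] (FockSpace (Fin 2) ℂ →L[ℂ] FockSpace (Fin 2) ℂ)}
    (hσ : IsFockAction σ) : IsFockRep σ := by
  have hΩ : (lp.single 2 [] 1 : FockSpace (Fin 2) ℂ) ≠ 0 := by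
    rw [← norm_ne_zero_iff, lp.norm_single (by norm_num)]
    simp
  refine ⟨⟨⟨_, _, hΩ⟩, fun K hK hinv => ?_⟩, _, hΩ, isVacuum_iff.1 (hσ.isVacuum hq 1)⟩
  refine eq_bot_or_eq_top_of_invariant hK (fun i f hf => ?_) fun i f hf => ?_
  · exact hσ i ▸ hinv _ f hf
  · exact hσ.apply_star i ▸ hinv _ f hf

/-- The Fock space tensored with `G` is a multiple of every Fock representation, so the kernel of a
Fock representation acts by zero on it. -/
lemma IsFockRep.fockAction_eq_zero (hq : ‖q‖ < 1)
    {H : Type*} [NormedAddCommGroup H] [InnerProductSpace ℂ H] [CompleteSpace H]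
    {π : O₂.{u} q →⋆ₐ[ℂ] (H →L[ℂ] H)} (hπ : IsFockRep π)
    {σ : O₂.{u} q →⋆ₐ[ℂ] (FockSpace (Fin 2) G →L[ℂ] FockSpace (Fin 2) G)}
    (hσ : IsFockAction σ) {a : O₂.{u} q} (ha : π a = 0) : σ a = 0 := by
  obtain ⟨_, Ω, hΩ0, hΩ⟩ := hπ
  rw [← isVacuum_iff] at hΩ
  -- testing against all right multiples of `a` makes `K` invariant under the creation operators
  let K : Submodule ℂ (FockSpace (Fin 2) G) :=
    ⨅ b : O₂.{u} q, LinearMap.ker (σ (a * b)).toLinearMap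
  have hmem : ∀ f, f ∈ K ↔ ∀ b, σ (a * b) f = 0 := fun f => by simp [K, Submodule.mem_iInf]
  have hK : IsClosed (K : Set (FockSpace (Fin 2) G)) := by
    have : (K : Set (FockSpace (Fin 2) G)) = ⋂ b : O₂.{u} q, {f | σ (a * b) f = 0} := by
      ext f
      simp [hmem]
    rw [this]
    exact isClosed_iInter fun b => isClosed_eq (σ (a * b)).continuous continuous_const
  have hK_top : K = ⊤ := by
    refine eq_top_of_single_nil_mem hK (fun g => (hmem _).2 fun b => ?_) fun i f hf =>
      (hmem _).2 fun b => ?_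
    · have h := hΩ.norm_mul_norm_eq (hσ.isVacuum hq g) (a * b)
      rw [map_mul π, ha, zero_mul, zero_apply, norm_zero, zero_mul] at h
      exact norm_eq_zero.1
        ((mul_eq_zero.1 h.symm).resolve_right (norm_ne_zero_iff.2 hΩ0))
    · rw [← hσ i, ← mul_apply_eq_comp, ← map_mul, mul_assoc]
      exact (hmem f).1 hf _
  ext1 f
  have := (hmem f).1 (hK_top ▸ trivial) 1
  rwa [mul_one] at this

/-- Every representation on `G` is weakly contained in the action on the Fock space tensored with
`G`. -/
lemma IsFockAction.eq_zero_of_eq_zero (hq : ‖q‖ < 1)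
    {σ : O₂.{u} q →⋆ₐ[ℂ] (FockSpace (Fin 2) G →L[ℂ] FockSpace (Fin 2) G)} (hσ : IsFockAction σ)
    (τ : O₂.{u} q →⋆ₐ[ℂ] (G →L[ℂ] G)) {a : O₂.{u} q} (ha : σ a = 0) : τ a = 0 := by
  have hT : IsCuntzToeplitz fun i => τ (orthGen q i) := (isCuntzToeplitz_orthGen hq).map τ
  have hpos : ∀ n : ℕ, (0 : ℝ) < 1 / ((n : ℝ) + 1) := fun n => by positivity
  choose K hKn hK hK' using fun n : ℕ => exists_asymptotic_intertwiner hT (hpos n)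
  have hK1 : ∀ n, ‖K n‖ ≤ 1 := fun n =>
    (K n).opNorm_le_bound zero_le_one fun h => by rw [hKn, one_mul]
  have htop : asymptoticIntertwined σ τ K = ⊤ := by
    refine eq_top_of_orthGen_mem hq (isClosed_asymptoticIntertwined σ τ hK1) (fun i => ?_)
      fun i => ?_
    · refine squeeze_zero_norm (fun n => ?_) tendsto_one_div_add_atTop_nhds_zero_nat
      rw [hσ i]
      exact hK n i
    · refine squeeze_zero_norm (fun n => ?_) tendsto_one_div_add_atTop_nhds_zero_nat
      rw [hσ.apply_star i, map_star τ]
      exact hK' n i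
  have hlim : Tendsto (fun n => σ a ∘L K n - K n ∘L τ a) atTop (𝓝 0) := by
    have : a ∈ asymptoticIntertwined σ τ K := htop ▸ trivial
    exact this
  ext h
  have h1 : Tendsto (fun n => ‖(σ a ∘L K n - K n ∘L τ a) h‖) atTop (𝓝 0) := by
    have := (((ContinuousLinearMap.apply ℂ (FockSpace (Fin 2) G) h).continuous.tendsto 0).comp
      hlim).norm
    simpa using this
  have h2 : ∀ n, ‖(σ a ∘L K n - K n ∘L τ a) h‖ = ‖τ a h‖ := fun n => by
    rw [ha]
    simp [hKn]
  simp_rw [h2] at h1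
  exact norm_eq_zero.1 (tendsto_nhds_unique tendsto_const_nhds h1)

instance [Nontrivial G] : Nontrivial (FockSpace (Fin 2) G) := by
  obtain ⟨g, hg⟩ := exists_ne (0 : G)
  refine ⟨lp.single 2 [] g, 0, ?_⟩
  rw [← norm_ne_zero_iff, lp.norm_single (by norm_num)]
  exact norm_ne_zero_iff.2 hg

lemma IsFockRep.injective (hq : ‖q‖ < 1)
    {H : Type*} [NormedAddCommGroup H] [InnerProductSpace ℂ H] [CompleteSpace H]
    {π : O₂.{u} q →⋆ₐ[ℂ] (H →L[ℂ] H)} (hπ : IsFockRep π) : Function.Injective π := by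
  refine (injective_iff_map_eq_zero π).2 fun a ha => Subtype.ext (Families.ext fun P => ?_)
  obtain ⟨S₂, h₂, hr, ht⟩ := exists_fock_pair (G := P.H) hq
  let F : HilbertPair.{u} q :=
    { H := FockSpace (Fin 2) P.H
      S₁ := create (Fin 2) P.H 0
      S₂ := S₂
      isometry₁ := star_create_mul_create 0 0
      isometry₂ := h₂
      rel := hr }
  have hF : IsFockAction (G := P.H) (O₂.lift F) := isFockAction_of rfl ht
  exact hF.eq_zero_of_eq_zero hq (O₂.lift P) (hπ.fockAction_eq_zero hq hF ha)

end FockRepresentation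

/-! ### Change of universe and existence -/

section Universe

variable {E : Type*} [NormedAddCommGroup E] [InnerProductSpace ℂ E]

/-- The inner product that `ULift E` takes from `E`. -/
noncomputable instance : InnerProductSpace ℂ (ULift.{u} E) where
  inner x y := inner ℂ x.down y.down
  norm_sq_eq_re_inner x := norm_sq_eq_re_inner (𝕜 := ℂ) x.down
  conj_inner_symm x y := inner_conj_symm x.down y.down
  add_left x y z := inner_add_left x.down y.down z.down
  smul_left x y r := inner_smul_left x.down y.down r

/-- The identification of `E` with its copy in another universe. -/
noncomputable def uliftIsometryEquiv (E : Type*) [NormedAddCommGroup E] [InnerProductSpace ℂ E] :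
    E ≃ₗᵢ[ℂ] ULift.{u} E where
  toLinearEquiv := ULift.moduleEquiv.symm
  norm_map' _ := rfl

end Universe

/-- A pair of isometries satisfying the relation extends to a representation of `O₂^q` on its own
space `H`, in any universe, provided that `H` has an isometric copy in the universe over which
`O₂^q` is formed. -/
lemma O₂.exists_rep {q : ℂ} {H : Type v} [NormedAddCommGroup H] [InnerProductSpace ℂ H]
    [CompleteSpace H] [Nontrivial H] {H' : Type u} [NormedAddCommGroup H']
    [InnerProductSpace ℂ H'] [CompleteSpace H'] (e : H ≃ₗᵢ[ℂ] H') {S₁ S₂ : H →L[ℂ] H}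
    (h₁ : star S₁ * S₁ = 1) (h₂ : star S₂ * S₂ = 1) (hr : star S₁ * S₂ = q • (S₂ * star S₁)) :
    ∃ σ : O₂.{u} q →⋆ₐ[ℂ] (H →L[ℂ] H), σ (O₂.s₁ q) = S₁ ∧ σ (O₂.s₂ q) = S₂ := by
  let P : HilbertPair.{u} q :=
    { H := H'
      nontrivial := e.symm.toEquiv.nontrivial
      S₁ := e.conjStarAlgEquiv S₁
      S₂ := e.conjStarAlgEquiv S₂
      isometry₁ := by rw [← map_star e.conjStarAlgEquiv, ← map_mul, h₁, map_one]
      isometry₂ := by rw [← map_star e.conjStarAlgEquiv, ← map_mul, h₂, map_one]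
      rel := by rw [← map_star e.conjStarAlgEquiv, ← map_mul, hr, map_smul, map_mul] }
  let c : (H' →L[ℂ] H') →⋆ₐ[ℂ] (H →L[ℂ] H) :=
    e.conjStarAlgEquiv.symm.toStarAlgHom
  exact ⟨c.comp (O₂.lift P), e.conjStarAlgEquiv.symm_apply_apply S₁,
    e.conjStarAlgEquiv.symm_apply_apply S₂⟩

lemma exists_isFockRep {q : ℂ} (hq : ‖q‖ < 1) :
    ∃ (H : Type v) (_ : NormedAddCommGroup H) (_ : InnerProductSpace ℂ H) (_ : CompleteSpace H)
      (π : O₂.{u} q →⋆ₐ[ℂ] (H →L[ℂ] H)), IsFockRep π := by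
  obtain ⟨S₂, h₂, hr, ht⟩ := exists_fock_pair (G := ℂ) hq
  obtain ⟨σ, hσ₁, hσ₂⟩ := O₂.exists_rep.{u}
    (uliftIsometryEquiv.{u} (FockSpace (Fin 2) ℂ)) (star_create_mul_create 0 0) h₂ hr
  have hσ : IsFockAction σ := isFockAction_of hσ₁ (hσ₂ ▸ ht)
  exact ⟨ULift.{v} (FockSpace (Fin 2) ℂ), inferInstance, inferInstance, inferInstance, _,
    (hσ.isFockRep hq).conj (uliftIsometryEquiv.{v} (FockSpace (Fin 2) ℂ))⟩

end QIsom

theorem mainTheorem6 (q : ℂ) (hq : ‖q‖ < 1) :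
    -- a Fock representation exists,
    (∃ (H : Type v) (_ : NormedAddCommGroup H) (_ : InnerProductSpace ℂ H) (_ : CompleteSpace H)
      (π : QIsom.O₂.{u} q →⋆ₐ[ℂ] (H →L[ℂ] H)), QIsom.IsFockRep π) ∧
    -- it is unique up to unitary equivalence,
    (∀ (H : Type v) [NormedAddCommGroup H] [InnerProductSpace ℂ H] [CompleteSpace H]
      (K : Type w) [NormedAddCommGroup K] [InnerProductSpace ℂ K] [CompleteSpace K]
      (π : QIsom.O₂.{u} q →⋆ₐ[ℂ] (H →L[ℂ] H)) (ρ : QIsom.O₂.{u} q →⋆ₐ[ℂ] (K →L[ℂ] K)),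
      QIsom.IsFockRep π → QIsom.IsFockRep ρ →
        ∃ U : H ≃ₗᵢ[ℂ] K, ∀ (a : QIsom.O₂.{u} q) (x : H), U (π a x) = ρ a (U x)) ∧
    -- and it is faithful
    (∀ (H : Type v) [NormedAddCommGroup H] [InnerProductSpace ℂ H] [CompleteSpace H]
      (π : QIsom.O₂.{u} q →⋆ₐ[ℂ] (H →L[ℂ] H)),
      QIsom.IsFockRep π → Function.Injective π) := 
  ⟨QIsom.exists_isFockRep hq, fun _ _ _ _ _ _ _ _ _ _ hπ hρ => hπ.exists_unitary hρ,
    fun _ _ _ _ _ hπ => hπ.injective hq⟩
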